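/- Let $X$ be a complex Banach space; all $L^p$-spaces consist of strongly measurable $X$-valued functions. **ACF.** Let $G$ be a compact (Hausdorff) abelian group with normalized Haar measure and dual group $\Gamma$, written additively. An order on $\Gamma$ is a set $P\subset\Gamma$ with $P+P\subset P$, $P\cap(-P)=\{0\}$ and $P\cup(-P)=\Gamma$; put $\operatorname{sgn}_P(\chi)=1,0,-1$ according as $\chi\in P\setminus\{0\}$, $\chi=0$, $\chi\in(-P)\setminus\{0\}$. On $X$-valued trigonometric polynomials define $$T_P\Big(\sum_{\chi\in\Gamma}a_\chi\,\chi\Big)=-i\sum_{\chi\in\Gamma}\operatorname{sgn}_P(\chi)\,a_\chi\,\chi .$$ For $1<p<\infty$ and $A\ge 0$, say that $A$ is an ACF constant of $X$ at $p$ if, for all such $G$ and all orders $P$ on $\Gamma$, $T_P$ extends to a linear operator on $L^p(G,X)$ with $\|T_Pf\|_{L^p(G,X)}\le A\|f\|_{L^p(G,X)}$ for all $f\in L^p(G,X)$. The space $X$ has the ACF property if for some $p\in(1,\infty)$ it has an ACF constant at $p$. **UMD.** For $1<p<\infty$ and $C\ge 0$, say that $C$ is a UMD constant of $X$ at $p$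 if $$\Big\|\sum_{j=1}^n\epsilon_jd_j\Big\|_{L^p(X)}\le C\,\Big\|\sum_{j=1}^nd_j\Big\|_{L^p(X)}\qquad(1.1)$$ for all $n\in\mathbb N$, all $X$-valued $L^p$-martingale difference sequences $(d_j)_{j\ge1}$ on a probability space (that is, the partial sums of $(d_j)$ form a martingale; $d_1$ need not have mean zero), and all $\epsilon_j\in\{-1,1\}$. The space $X$ is UMD if for some $p\in(1,\infty)$ it has a UMD constant at $p$. **Theorem 3.1.** Let $X$ be a complex Banach space and $1<p<\infty$. If $X$ has the ACF property, then $X$ is a UMD space, and (1.1) holds at $p$ with $C=A^2$ for every ACF constant $A$ of $X$ at $p$; that is, the least constants satisfy $C_p(X)\le A_p(X)^2$ whenever $A_p(X)$ exists. -/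

import Mathlib

open MeasureTheory
open scoped ENNReal NNReal

universe u w

/-- An order on a (multiplicatively written) abelian group `Γ`: `P * P ⊆ P`, `P ∩ P⁻¹ = {1}`
and `P ∪ P⁻¹ = Γ`. -/
structure IsGroupOrder {Γ : Type*} [CommGroup Γ] (P : Set Γ) : Prop where
  mul_mem : ∀ ⦃a b : Γ⦄, a ∈ P → b ∈ P → a * b ∈ P
  mem_and_inv_mem_iff : ∀ a : Γ, (a ∈ P ∧ a⁻¹ ∈ P) ↔ a = 1
  mem_or_inv_mem : ∀ a : Γ, a ∈ P ∨ a⁻¹ ∈ P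

open Classical in
/-- The signum function of an order: `0` at the identity, `1` on the rest of `P`, `-1` off `P`. -/
noncomputable def orderSgn {Γ : Type*} [CommGroup Γ] (P : Set Γ) (a : Γ) : ℂ :=
  if a = 1 then 0 else if a ∈ P then 1 else -1

/-- The `X`-valued trigonometric polynomial `x ↦ ∑ χ, χ(x) • c χ` on `G`, with finitely many
nonzero coefficients `c χ`. -/
noncomputable def trigPoly {G X : Type*} [CommGroup G] [TopologicalSpace G]
    [NormedAddCommGroup X] [NormedSpace ℂ X] (c : PontryaginDual G →₀ X) (x : G) : X :=
  c.sum fun χ a => ((χ x : Circle) : ℂ) • a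

/-- The conjugate function `-i ∑ χ, sgn_P(χ) χ(x) • c χ` of the trigonometric polynomial with
coefficients `c`. -/
noncomputable def conjTrigPoly {G X : Type*} [CommGroup G] [TopologicalSpace G]
    [NormedAddCommGroup X] [NormedSpace ℂ X] (P : Set (PontryaginDual G))
    (c : PontryaginDual G →₀ X) (x : G) : X :=
  -Complex.I • c.sum fun χ a => (orderSgn P χ * ((χ x : Circle) : ℂ)) • a

/-- `A` is an admissible ACF constant of `X` at the exponent `p`: for each compact (Hausdorff)
abelian group `G` with normalized Haar measure `μ` and each order `P` on its dual group, the
conjugate function operator extends to a linear operator on `L^p(G, X)` of norm at most `A`.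

The groups range over `Type`, the smallest universe; as this notion is a hypothesis of the theorem,
that makes the theorem no weaker than with a larger universe. -/
def ACFBound (X : Type*) [NormedAddCommGroup X] [NormedSpace ℂ X] (p : ℝ≥0∞) (A : ℝ≥0) : Prop :=
  ∀ (G : Type) [CommGroup G] [TopologicalSpace G] [IsTopologicalGroup G] [CompactSpace G]
    [T2Space G] [MeasurableSpace G] [BorelSpace G]
    (μ : Measure G) [μ.IsHaarMeasure] [μ.Regular] [IsProbabilityMeasure μ]
    (P : Set (PontryaginDual G)), IsGroupOrder P →
    ∃ T : Lp X p μ →ₗ[ℂ] Lp X p μ,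
      (∀ (c : PontryaginDual G →₀ X) (f : Lp X p μ),
        f =ᵐ[μ] trigPoly c → T f =ᵐ[μ] conjTrigPoly P c) ∧
      ∀ f : Lp X p μ, ‖T f‖ ≤ A * ‖f‖

/-- The abstract conjugate function property. -/
def HasACF (X : Type*) [NormedAddCommGroup X] [NormedSpace ℂ X] : Prop :=
  ∃ p : ℝ≥0∞, 1 < p ∧ p < ∞ ∧ ∃ A : ℝ≥0, ACFBound X p A

/-- `d` is a martingale difference sequence for the filtration `ℱ`: its partial sums
`d 0 + ⋯ + d n` form a martingale. The first term `d 0` need not have mean zero. -/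
def IsMartingaleDifference {Ω X : Type*} [NormedAddCommGroup X] [NormedSpace ℝ X] [CompleteSpace X]
    {m : MeasurableSpace Ω} (d : ℕ → Ω → X) (ℱ : Filtration ℕ m) (μ : Measure Ω) : Prop :=
  Martingale (fun n => ∑ j ∈ Finset.range (n + 1), d j) ℱ μ

/-- `C` is an admissible UMD constant of `X` at the exponent `p`. -/
def UMDBound (X : Type u) [NormedAddCommGroup X] [NormedSpace ℝ X] [CompleteSpace X]
    (p : ℝ≥0∞) (C : ℝ≥0) : Prop :=
  ∀ (Ω : Type w) (m : MeasurableSpace Ω) (μ : Measure Ω) [IsProbabilityMeasure μ]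
    (ℱ : Filtration ℕ m) (d : ℕ → Ω → X),
    IsMartingaleDifference d ℱ μ → (∀ j, MemLp (d j) p μ) →
    ∀ ε : ℕ → ℝ, (∀ j, ε j = 1 ∨ ε j = -1) → ∀ n : ℕ,
      eLpNorm (∑ j ∈ Finset.range n, ε j • d j) p μ
        ≤ C * eLpNorm (∑ j ∈ Finset.range n, d j) p μ

/-- The UMD property. -/
def HasUMD (X : Type u) [NormedAddCommGroup X] [NormedSpace ℝ X] [CompleteSpace X] : Prop :=
  ∃ p : ℝ≥0∞, 1 < p ∧ p < ∞ ∧ ∃ C : ℝ≥0, UMDBound.{u, w} X p C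

/-! On the torus `Fin n → Circle`, order the characters lexicographically, letting the last
coordinate with nonzero exponent decide, and flip the sign of coordinate `k` by `s k = ±1`. If `P`
is this order and `Q` the unflipped one, then `sgn_P * sgn_Q` equals `s k` on every character whose
last active coordinate is `k` (`orderSgn_mul_orderSgn`). A function of coordinates `0, …, k` with
mean zero in coordinate `k` has its Fourier support in exactly these characters
(`integral_charMap_smul_torus_eq_zero`). Hence `-T_P T_Q` maps `∑ D k` to `∑ s k • D k`, and two
applications of the ACF bound give the constant `A ^ 2` (`eLpNorm_sum_smul_torus_le`).

A general martingale reduces to this case because both norms in (1.1) depend only on the joint law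
of the differences. Drawing each term from its conditional law given the earlier ones, with one
independent circle coordinate per step, reproduces that law on the torus
(`exists_torus_realization`). The first difference need not be centred, so all differences are first
multiplied by one independent uniform unimodular variable: this changes no norm and makes the first
term mean zero (`umdBound_of_acfBound`). -/

/-! ### Characters of compact abelian groups: density and uniqueness of Fourier coefficients. -/

section CompactGroup

variable {G : Type*} [CommGroup G] [TopologicalSpace G]

/-- A character of `G` as a continuous complex-valued function. -/
noncomputable def charMap (χ : PontryaginDual G) : C(G, ℂ) :=
  ⟨fun x => ((χ x : Circle) : ℂ), continuous_subtype_val.comp (map_continuous χ)⟩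

theorem charMap_apply (χ : PontryaginDual G) (x : G) : charMap χ x = ((χ x : Circle) : ℂ) := rfl

theorem charMap_mul (χ ψ : PontryaginDual G) (x : G) :
    charMap (χ * ψ) x = charMap χ x * charMap ψ x := rfl

theorem charMap_apply_mul (χ : PontryaginDual G) (x y : G) :
    charMap χ (x * y) = charMap χ x * charMap χ y := by
  rw [charMap_apply, map_mul, Circle.coe_mul]; rfl

@[simp]
theorem norm_charMap (χ : PontryaginDual G) (x : G) : ‖charMap χ x‖ = 1 := Circle.norm_coe _

theorem charMap_eq_one_iff (χ : PontryaginDual G) (x : G) : charMap χ x = 1 ↔ χ x = 1 :=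
  Circle.coe_eq_one

theorem star_charMap (χ : PontryaginDual G) : star (charMap χ) = charMap χ⁻¹ := by
  ext x
  exact (Circle.coe_inv_eq_conj (χ x)).symm

variable [CompactSpace G]

/-- The characters in a subgroup of the dual that separates the points of `G` span a dense subspace
of `C(G, ℂ)`. -/
theorem span_charMap_topologicalClosure (S : Subgroup (PontryaginDual G))
    (hS : ∀ x y : G, x ≠ y → ∃ χ ∈ S, χ x ≠ χ y) :
    (Submodule.span ℂ (charMap '' (S : Set (PontryaginDual G)))).topologicalClosure = ⊤ := by
  set R : Set C(G, ℂ) := charMap '' (S : Set (PontryaginDual G)) with hR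
  have hstar : ∀ f ∈ R, star f ∈ R := by
    rintro _ ⟨χ, hχ, rfl⟩
    exact ⟨χ⁻¹, S.inv_mem hχ, (star_charMap χ).symm⟩
  let B : StarSubalgebra ℂ C(G, ℂ) :=
    { toSubalgebra := Algebra.adjoin ℂ R
      star_mem' := by
        change Algebra.adjoin ℂ R ≤ star (Algebra.adjoin ℂ R)
        refine Algebra.adjoin_le fun f hf => ?_
        exact Algebra.subset_adjoin (hstar f hf) }
  -- The characters in `S` are closed under products, so the algebra they generate is only their
  -- linear span; Stone–Weierstrass then applies to it.
  have hB : B.toSubalgebra.toSubmodule = Submodule.span ℂ R := by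
    apply Algebra.adjoin_eq_span_of_subset
    refine Set.Subset.trans (fun x => Submonoid.closure_induction (fun _ h => h) ?_ ?_)
      Submodule.subset_span
    · exact ⟨1, S.one_mem, rfl⟩
    · rintro _ _ _ _ ⟨χ, hχ, rfl⟩ ⟨ψ, hψ, rfl⟩
      exact ⟨χ * ψ, S.mul_mem hχ hψ, rfl⟩
  have hsep : B.SeparatesPoints := by
    intro x y hxy
    obtain ⟨χ, hχ, h⟩ := hS x y hxy
    exact ⟨_, ⟨charMap χ, Algebra.subset_adjoin ⟨χ, hχ, rfl⟩, rfl⟩,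
      fun H => h (Circle.coe_injective H)⟩
  rw [← hB]
  exact congr_arg (Subalgebra.toSubmodule <| StarSubalgebra.toSubalgebra ·)
    (ContinuousMap.starSubalgebra_topologicalClosure_eq_top_of_separatesPoints B hsep)

variable [IsTopologicalGroup G] [MeasurableSpace G] [BorelSpace G]
  (μ : Measure G) [μ.IsHaarMeasure] [IsProbabilityMeasure μ]

/-- Translating by a point `y` with `χ y ≠ 1` multiplies the integral by `χ y` and, by invariance,
leaves it unchanged. -/
theorem integral_charMap {χ : PontryaginDual G} (h : χ ≠ 1) : ∫ x, charMap χ x ∂μ = 0 := by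
  obtain ⟨y, hy⟩ : ∃ y, χ y ≠ 1 := by
    by_contra! H
    exact h (PontryaginDual.ext H)
  have h1 : ∫ x, charMap χ x ∂μ = charMap χ y * ∫ x, charMap χ x ∂μ := by
    conv_lhs => rw [← integral_mul_left_eq_self _ y]
    rw [← integral_const_mul]
    simp only [charMap_apply_mul]
  have h2 : (charMap χ y - 1) * ∫ x, charMap χ x ∂μ = 0 := by
    rw [sub_mul, ← h1]; ring
  rcases mul_eq_zero.1 h2 with h3 | h3
  · exact absurd ((charMap_eq_one_iff χ y).1 (sub_eq_zero.1 h3)) hy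
  · exact h3

variable {X : Type*} [NormedAddCommGroup X] [NormedSpace ℂ X]

omit [IsTopologicalGroup G] [μ.IsHaarMeasure] [IsProbabilityMeasure μ] in
theorem integrable_continuousMap_smul {f : G → X} (hf : Integrable f μ) (g : C(G, ℂ)) :
    Integrable (fun x => g x • f x) μ :=
  hf.bdd_smul ‖g‖ g.continuous.aestronglyMeasurable
    (Filter.Eventually.of_forall fun x => g.norm_coe_le_norm x)

/-- Integration of `f` against continuous functions. -/
noncomputable def integralPairing {f : G → X} (hf : Integrable f μ) :
    C(G, ℂ) →L[ℂ] X :=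
  LinearMap.mkContinuous
    { toFun := fun g => ∫ x, g x • f x ∂μ
      map_add' := fun g h => by
        rw [← integral_add (integrable_continuousMap_smul μ hf g)
          (integrable_continuousMap_smul μ hf h)]
        simp [add_smul]
      map_smul' := fun c g => by
        rw [RingHom.id_apply, ← integral_smul]
        simp [mul_smul] }
    (∫ x, ‖f x‖ ∂μ) fun g => by
      refine (norm_integral_le_integral_norm _).trans ?_
      rw [← integral_mul_const]
      refine integral_mono_of_nonneg (Filter.Eventually.of_forall fun x => norm_nonneg _)
        (hf.norm.mul_const _) (Filter.Eventually.of_forall fun x => ?_)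
      simp only [norm_smul]
      rw [mul_comm]
      exact mul_le_mul_of_nonneg_left (g.norm_coe_le_norm x) (norm_nonneg _)

omit [IsTopologicalGroup G] [μ.IsHaarMeasure] [IsProbabilityMeasure μ] in
/-- An integrable function all of whose Fourier coefficients along a point-separating subgroup of
the dual vanish is null. -/
theorem ae_eq_zero_of_fourier_eq_zero [HasOuterApproxClosed G] [CompleteSpace X]
    (S : Subgroup (PontryaginDual G))
    (hS : ∀ x y : G, x ≠ y → ∃ χ ∈ S, χ x ≠ χ y) {f : G → X} (hf : Integrable f μ)
    (h : ∀ χ ∈ S, ∫ x, charMap χ x • f x ∂μ = 0) : f =ᵐ[μ] 0 := by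
  have hL : integralPairing μ hf = 0 := by
    refine ContinuousLinearMap.ext_on (s := charMap '' (S : Set (PontryaginDual G))) ?_ ?_
    · exact Submodule.dense_iff_topologicalClosure_eq_top.2 (span_charMap_topologicalClosure S hS)
    · rintro _ ⟨χ, hχ, rfl⟩
      exact h χ hχ
  -- The pairing with continuous functions vanishes; indicators of closed sets are bounded pointwise
  -- limits of such functions.
  refine ae_eq_zero_of_forall_setIntegral_isClosed_eq_zero hf fun F hF => ?_
  have h0 : ∀ n, ∫ x, ((hF.apprSeq n x : ℝ) : ℂ) • f x ∂μ = 0 := fun n => by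
    have := DFunLike.congr_fun hL (⟨fun x => ((hF.apprSeq n x : ℝ) : ℂ), by fun_prop⟩ : C(G, ℂ))
    exact this
  have hlim : Filter.Tendsto (fun n => ∫ x, ((hF.apprSeq n x : ℝ) : ℂ) • f x ∂μ) Filter.atTop
      (nhds (∫ x, F.indicator f x ∂μ)) := by
    refine tendsto_integral_of_dominated_convergence (fun x => ‖f x‖) ?_ hf.norm ?_ ?_
    · intro n
      exact (Continuous.aestronglyMeasurable (by fun_prop)).smul hf.1
    · intro n
      refine Filter.Eventually.of_forall fun x => ?_
      rw [norm_smul]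
      refine mul_le_of_le_one_left (norm_nonneg _) ?_
      simpa using HasOuterApproxClosed.apprSeq_apply_le_one hF n x
    · refine Filter.Eventually.of_forall fun x => ?_
      have h1 := tendsto_pi_nhds.1 (HasOuterApproxClosed.tendsto_apprSeq hF) x
      have h2 : Filter.Tendsto (fun n => (((hF.apprSeq n x : ℝ≥0) : ℝ) : ℂ)) Filter.atTop
          (nhds (((F.indicator (fun _ => (1 : ℝ≥0)) x : ℝ≥0) : ℝ) : ℂ)) :=
        (Complex.continuous_ofReal.tendsto _).comp
          ((NNReal.continuous_coe.tendsto _).comp h1)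
      have h3 := h2.smul_const (f x)
      by_cases hx : x ∈ F <;> simpa [hx] using h3
  rw [← integral_indicator hF.measurableSet]
  refine tendsto_nhds_unique hlim ?_
  simp only [h0]
  exact tendsto_const_nhds

include μ in
/-- A subgroup of the dual that separates points is the whole dual. -/
theorem subgroup_eq_top_of_separates [HasOuterApproxClosed G] (S : Subgroup (PontryaginDual G))
    (hS : ∀ x y : G, x ≠ y → ∃ χ ∈ S, χ x ≠ χ y) : S = ⊤ := by
  refine (Subgroup.eq_top_iff' S).2 fun ψ => ?_
  by_contra hψ
  have hint : Integrable (charMap ψ) μ :=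
    (integrable_const (1 : ℝ)).mono' (charMap ψ).continuous.aestronglyMeasurable
      (Filter.Eventually.of_forall fun x => by simp)
  -- A character outside `S` is orthogonal to all of `S`, so it would vanish almost everywhere,
  -- although its modulus is 1.
  have h0 := ae_eq_zero_of_fourier_eq_zero μ S hS hint fun χ hχ => by
    have hne : χ * ψ ≠ 1 := fun h => hψ (by
      rw [← inv_eq_of_mul_eq_one_right h]
      exact S.inv_mem hχ)
    exact integral_charMap μ hne
  have : ∀ᵐ x ∂μ, False := by
    filter_upwards [h0] with x hx
    have := norm_charMap ψ x
    rw [hx] at this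
    simp at this
  simp [IsProbabilityMeasure.ne_zero] at this

end CompactGroup

/-! ### Conjugate function operators as Fourier multipliers. -/

section Multiplier

variable {G : Type*} [CommGroup G] [TopologicalSpace G] [CompactSpace G]
  [IsTopologicalGroup G] [MeasurableSpace G] [BorelSpace G]
  (μ : Measure G) [μ.IsHaarMeasure] [IsProbabilityMeasure μ]
  {X : Type*} [NormedAddCommGroup X] [NormedSpace ℂ X] {p : ℝ≥0∞}

/-- Fourier coefficient of an `L^p` function, as a continuous linear map. -/
noncomputable def fourierCoeffLp [Fact (1 ≤ p)] (χ : PontryaginDual G) : Lp X p μ →L[ℂ] X :=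
  LinearMap.mkContinuous
    { toFun := fun f => ∫ x, charMap χ⁻¹ x • f x ∂μ
      map_add' := fun f g => by
        rw [← integral_add
          (integrable_continuousMap_smul μ ((Lp.memLp f).integrable Fact.out) _)
          (integrable_continuousMap_smul μ ((Lp.memLp g).integrable Fact.out) _)]
        refine integral_congr_ae ?_
        filter_upwards [Lp.coeFn_add f g] with x hx
        rw [hx, Pi.add_apply, smul_add]
      map_smul' := fun c f => by
        rw [RingHom.id_apply, ← integral_smul]
        refine integral_congr_ae ?_
        filter_upwards [Lp.coeFn_smul c f] with x hx
        rw [hx, Pi.smul_apply, smul_comm] }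
    1 fun f => by
      refine (norm_integral_le_integral_norm _).trans ?_
      simp only [norm_smul, norm_charMap, one_mul]
      rw [integral_norm_eq_lintegral_enorm (Lp.aestronglyMeasurable f), Lp.norm_def,
        ← eLpNorm_one_eq_lintegral_enorm]
      exact ENNReal.toReal_mono (Lp.eLpNorm_ne_top f)
        (eLpNorm_le_eLpNorm_of_exponent_le Fact.out (Lp.aestronglyMeasurable f))

theorem fourierCoeffLp_apply [Fact (1 ≤ p)] (χ : PontryaginDual G) (f : Lp X p μ) :
    fourierCoeffLp μ χ f = ∫ x, charMap χ⁻¹ x • f x ∂μ := rfl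

theorem fourierCoeffLp_of_ae_eq [Fact (1 ≤ p)] (χ : PontryaginDual G) {f : Lp X p μ} {g : G → X}
    (h : f =ᵐ[μ] g) : fourierCoeffLp μ χ f = ∫ x, charMap χ⁻¹ x • g x ∂μ := by
  refine integral_congr_ae ?_
  filter_upwards [h] with x hx
  rw [hx]

/-- An operator that extends the conjugation operator of the order `P` acts on Fourier
coefficients by the multiplier `-i sgn_P`. -/
theorem fourierCoeffLp_conj [Fact (1 ≤ p)] [CompleteSpace X] [μ.WeaklyRegular] [NormalSpace G]
    (hp : p ≠ ∞)
    (hS : ∀ x y : G, x ≠ y → ∃ χ : PontryaginDual G, χ x ≠ χ y) {P : Set (PontryaginDual G)}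
    (T : Lp X p μ →L[ℂ] Lp X p μ)
    (hT : ∀ (c : PontryaginDual G →₀ X) (f : Lp X p μ),
        f =ᵐ[μ] trigPoly c → T f =ᵐ[μ] conjTrigPoly P c)
    (χ : PontryaginDual G) (f : Lp X p μ) :
    fourierCoeffLp μ χ (T f) = (-Complex.I * orderSgn P χ) • fourierCoeffLp μ χ f := by
  set L₁ : Lp X p μ →L[ℂ] X := (fourierCoeffLp μ χ).comp T
  set L₂ : Lp X p μ →L[ℂ] X := (-Complex.I * orderSgn P χ) • fourierCoeffLp μ χ
  let J : X → Lp ℂ p μ →L[ℂ] Lp X p μ := fun a =>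
    ((1 : ℂ →L[ℂ] ℂ).smulRight a).compLpL p μ
  have hJ : ∀ a (g : Lp ℂ p μ), J a g =ᵐ[μ] fun x => g x • a := fun a g => by
    filter_upwards [ContinuousLinearMap.coeFn_compLpL ((1 : ℂ →L[ℂ] ℂ).smulRight a) g] with x hx
    rw [hx]
    simp
  -- On functions `g • a` with `g` scalar and `a` fixed, the identity need only be checked for
  -- characters `g`, whose span is dense in scalar `L^p`.
  have key : ∀ a, L₁.comp (J a) = L₂.comp (J a) := by
    intro a
    refine ContinuousLinearMap.ext_on
      (s := ContinuousMap.toLp (E := ℂ) p μ ℂ '' (charMap '' Set.univ)) ?_ ?_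
    · have h1 := (ContinuousMap.toLp_denseRange ℂ μ ℂ hp).topologicalClosure_map_submodule
        (span_charMap_topologicalClosure (⊤ : Subgroup (PontryaginDual G))
          fun x y hxy => (hS x y hxy).imp fun χ h => ⟨trivial, h⟩)
      rw [Submodule.map_span] at h1
      exact Submodule.dense_iff_topologicalClosure_eq_top.2 h1
    · rintro _ ⟨_, ⟨ψ, -, rfl⟩, rfl⟩
      set g : Lp ℂ p μ := ContinuousMap.toLp (E := ℂ) p μ ℂ (charMap ψ)
      have hg : J a g =ᵐ[μ] fun x => charMap ψ x • a := by
        filter_upwards [hJ a g, ContinuousMap.coeFn_toLp (p := p) (𝕜 := ℂ) μ (charMap ψ)]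
          with x hx hx'
        rw [hx, hx']
      have h1 : J a g =ᵐ[μ] trigPoly (Finsupp.single ψ a) := by
        refine hg.trans (Filter.Eventually.of_forall fun x => ?_)
        simp [trigPoly, charMap_apply]
      have h2 : T (J a g) =ᵐ[μ] fun x => (-Complex.I * orderSgn P ψ) • charMap ψ x • a := by
        refine (hT _ _ h1).trans (Filter.Eventually.of_forall fun x => ?_)
        simp [conjTrigPoly, charMap_apply, smul_smul, mul_assoc]
      change fourierCoeffLp μ χ (T (J a g))
        = (-Complex.I * orderSgn P χ) • fourierCoeffLp μ χ (J a g)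
      rw [fourierCoeffLp_of_ae_eq μ χ h2, fourierCoeffLp_of_ae_eq μ χ hg]
      by_cases h : ψ = χ
      · subst h
        rw [← integral_smul]
        congr 1
        ext x
        rw [smul_comm]
      · have hz : ∫ x, charMap χ⁻¹ x • charMap ψ x • a ∂μ = 0 := by
          simp_rw [smul_smul, ← charMap_mul]
          rw [integral_smul_const, integral_charMap μ, zero_smul]
          rwa [ne_eq, inv_mul_eq_one, eq_comm]
        simp_rw [smul_comm _ (-Complex.I * orderSgn P ψ)]
        rw [integral_smul, hz, smul_zero, smul_zero]
  -- Indicators with vector values are of the form `J c g`, and they generate `L^p(G, X)`.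
  change L₁ f = L₂ f
  refine Lp.induction hp (fun f => L₁ f = L₂ f) ?_ ?_ ?_ f
  · intro c s hs hμs
    have : (Lp.simpleFunc.indicatorConst p hs hμs.ne c : Lp X p μ)
        = J c (indicatorConstLp p hs hμs.ne 1) := by
      refine Lp.ext ?_
      rw [Lp.simpleFunc.coe_indicatorConst]
      filter_upwards [hJ c (indicatorConstLp p hs hμs.ne 1),
        indicatorConstLp_coeFn (p := p) (hs := hs) (hμs := hμs.ne) (c := c),
        indicatorConstLp_coeFn (p := p) (hs := hs) (hμs := hμs.ne) (c := (1 : ℂ))] with x h1 h2 h3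
      rw [h1, h2, h3]
      by_cases hx : x ∈ s <;> simp [hx]
    rw [this]
    exact DFunLike.congr_fun (key c) _
  · intro f g hf hg _ h1 h2
    rw [map_add, map_add, h1, h2]
  · exact isClosed_eq L₁.continuous L₂.continuous

/-- If on the Fourier support of `f ∈ L^p` the product of the signum functions of two orders acts
as prescribed by `g ∈ L^p`, then `‖g‖ ≤ A² ‖f‖`. -/
theorem eLpNorm_le_of_acfBound {G : Type} [CommGroup G] [TopologicalSpace G] [CompactSpace G]
    [T2Space G] [IsTopologicalGroup G] [MeasurableSpace G] [BorelSpace G] [HasOuterApproxClosed G]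
    (μ : Measure G) [μ.IsHaarMeasure] [IsProbabilityMeasure μ] [μ.Regular] [CompleteSpace X]
    {A : ℝ≥0} (hA : ACFBound X p A) (hp1 : 1 ≤ p) (hp : p ≠ ∞)
    (hS : ∀ x y : G, x ≠ y → ∃ χ : PontryaginDual G, χ x ≠ χ y)
    {P Q : Set (PontryaginDual G)} (hP : IsGroupOrder P) (hQ : IsGroupOrder Q)
    {f g : G → X} (hf : MemLp f p μ) (hg : MemLp g p μ)
    (h : ∀ χ, ∫ x, charMap χ⁻¹ x • g x ∂μ
      = (orderSgn P χ * orderSgn Q χ) • ∫ x, charMap χ⁻¹ x • f x ∂μ) :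
    eLpNorm g p μ ≤ (A ^ 2 : ℝ≥0) * eLpNorm f p μ := by
  have : Fact (1 ≤ p) := ⟨hp1⟩
  obtain ⟨T, hT, hTA⟩ := hA G μ P hP
  obtain ⟨U, hU, hUA⟩ := hA G μ Q hQ
  set T' : Lp X p μ →L[ℂ] Lp X p μ := T.mkContinuous A hTA
  set U' : Lp X p μ →L[ℂ] Lp X p μ := U.mkContinuous A hUA
  have hcT := fourierCoeffLp_conj μ hp hS T' hT
  have hcU := fourierCoeffLp_conj μ hp hS U' hU
  -- The minus sign comes from `(-i)² = -1`; both sides have the same Fourier coefficients.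
  have hgf : hg.toLp g = - T' (U' (hf.toLp f)) := by
    have h0 : (hg.toLp g + T' (U' (hf.toLp f)) : Lp X p μ) =ᵐ[μ] 0 := by
      refine ae_eq_zero_of_fourier_eq_zero μ (⊤ : Subgroup (PontryaginDual G))
        (fun x y hxy => (hS x y hxy).imp fun χ h => ⟨trivial, h⟩)
        ((Lp.memLp _).integrable hp1) fun χ _ => ?_
      have := fourierCoeffLp_apply μ χ⁻¹ (hg.toLp g + T' (U' (hf.toLp f)) : Lp X p μ)
      rw [inv_inv] at this
      rw [← this, map_add, hcT, hcU, fourierCoeffLp_of_ae_eq μ _ hg.coeFn_toLp,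
        fourierCoeffLp_of_ae_eq μ _ hf.coeFn_toLp, h, smul_smul, ← add_smul]
      have : orderSgn P χ⁻¹ * orderSgn Q χ⁻¹
          + -Complex.I * orderSgn P χ⁻¹ * (-Complex.I * orderSgn Q χ⁻¹) = 0 := by
        linear_combination orderSgn P χ⁻¹ * orderSgn Q χ⁻¹ * Complex.I_mul_I
      rw [this, zero_smul]
    exact eq_neg_of_add_eq_zero_left ((Lp.eq_zero_iff_ae_eq_zero).2 h0)
  have hn : ‖hg.toLp g‖ ≤ (A ^ 2 : ℝ≥0) * ‖hf.toLp f‖ := by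
    rw [hgf, norm_neg]
    calc ‖T' (U' (hf.toLp f))‖ ≤ A * ‖U' (hf.toLp f)‖ := hTA _
      _ ≤ A * (A * ‖hf.toLp f‖) := mul_le_mul_of_nonneg_left (hUA _) A.2
      _ = _ := by push_cast; ring
  rw [Lp.norm_toLp, Lp.norm_toLp] at hn
  rw [← ENNReal.toReal_le_toReal hg.eLpNorm_ne_top (ENNReal.mul_ne_top (by simp) hf.eLpNorm_ne_top),
    ENNReal.toReal_mul]
  simpa using hn

end Multiplier

/-! ### Haar measure and characters of the circle. -/

section CircleGroup

noncomputable instance : MeasurableSpace Circle := borel Circle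

instance : BorelSpace Circle := ⟨rfl⟩

/-- The normalized Haar measure of the circle. -/
noncomputable def circleHaar : Measure Circle :=
  (volume : Measure UnitAddCircle).map AddCircle.toCircle

theorem measurable_toCircle : Measurable (AddCircle.toCircle : UnitAddCircle → Circle) :=
  AddCircle.continuous_toCircle.measurable

instance : IsProbabilityMeasure circleHaar :=
  have : IsProbabilityMeasure (volume : Measure UnitAddCircle) := ⟨UnitAddCircle.measure_univ⟩
  Measure.isProbabilityMeasure_map measurable_toCircle.aemeasurable

theorem surjective_toCircle : Function.Surjective (AddCircle.toCircle : UnitAddCircle → Circle) := by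
  intro z
  obtain ⟨t, rfl⟩ := (AddCircle.homeomorphCircle (one_ne_zero (α := ℝ))).surjective z
  exact ⟨t, (AddCircle.homeomorphCircle_apply _ t).symm⟩

instance : circleHaar.IsMulLeftInvariant where
  map_mul_left_eq_self z := by
    obtain ⟨t, rfl⟩ := surjective_toCircle z
    have h : (fun w => AddCircle.toCircle t * w) ∘ (AddCircle.toCircle : UnitAddCircle → Circle)
        = AddCircle.toCircle ∘ fun s => t + s := by
      ext s
      simp [AddCircle.toCircle_add]
    rw [circleHaar, Measure.map_map (by fun_prop) measurable_toCircle, h,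
      ← Measure.map_map measurable_toCircle (by fun_prop), map_add_left_eq_self]

instance : circleHaar.IsOpenPosMeasure :=
  AddCircle.continuous_toCircle.isOpenPosMeasure_map surjective_toCircle

instance : circleHaar.IsHaarMeasure where

/-- The circle carries a uniformly distributed `[0, 1]`-valued random variable. -/
theorem exists_measurePreserving_circle_unitInterval :
    ∃ v : Circle → unitInterval, MeasurePreserving v circleHaar volume := by
  let e := AddCircle.homeomorphCircle (one_ne_zero (α := ℝ))
  let r : UnitAddCircle → ℝ := fun t => (AddCircle.equivIoc 1 0 t : ℝ)
  have hr : MeasurePreserving r volume (volume.restrict (Set.Ioc 0 (0 + 1))) :=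
    (measurePreserving_subtype_coe measurableSet_Ioc).comp (AddCircle.measurePreserving_equivIoc 1)
  have he : MeasurePreserving e.symm circleHaar volume := by
    refine ⟨e.symm.continuous.measurable, ?_⟩
    rw [circleHaar, Measure.map_map e.symm.continuous.measurable measurable_toCircle]
    have : (e.symm : Circle → UnitAddCircle) ∘ AddCircle.toCircle = id := by
      ext t
      simp [e, ← AddCircle.homeomorphCircle_apply (one_ne_zero (α := ℝ))]
    rw [this, Measure.map_id]
  let q : ℝ → unitInterval := Set.projIcc 0 1 zero_le_one
  have hq : Measurable q := continuous_projIcc.measurable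
  -- Passing from `(0, 1]` to `[0, 1]` only adds a null endpoint.
  have hq' : MeasurePreserving q (volume.restrict (Set.Ioc 0 (0 + 1))) volume := by
    refine ⟨hq, ?_⟩
    have hemb : MeasurableEmbedding (Subtype.val : unitInterval → ℝ) :=
      MeasurableEmbedding.subtype_coe measurableSet_Icc
    have h1 : ((volume.restrict (Set.Ioc (0 : ℝ) (0 + 1))).map q).map Subtype.val
        = (volume : Measure unitInterval).map Subtype.val := by
      have hv : (volume : Measure unitInterval) = Measure.comap Subtype.val volume := rfl
      rw [Measure.map_map measurable_subtype_coe hq, hv,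
        (measurePreserving_subtype_coe measurableSet_Icc).map_eq, zero_add,
        ← restrict_Ioc_eq_restrict_Icc]
      conv_rhs => rw [← Measure.map_id (μ := volume.restrict (Set.Ioc (0 : ℝ) 1))]
      refine Measure.map_congr ?_
      filter_upwards [ae_restrict_mem measurableSet_Ioc] with x hx
      simp [q, Set.projIcc_of_mem zero_le_one (Set.Ioc_subset_Icc_self hx)]
    rw [← hemb.comap_map ((volume.restrict (Set.Ioc (0 : ℝ) (0 + 1))).map q), h1,
      hemb.comap_map]
  exact ⟨q ∘ r ∘ e.symm, hq'.comp (hr.comp he)⟩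

/-- For `m ≠ 0` the point `Circle.exp (π / m)` has `m`-th power `-1`. -/
theorem Circle.zpow_eq_one_iff_forall (m : ℤ) : (∀ z : Circle, z ^ m = 1) ↔ m = 0 := by
  refine ⟨fun h => ?_, fun h => by simp [h]⟩
  by_contra hm
  refine Circle.exp_pi_ne_one ?_
  have := h (Circle.exp (Real.pi / m))
  rw [← Circle.exp_zsmul, zsmul_eq_mul, mul_div_cancel₀] at this
  · exact this
  · exact_mod_cast hm

/-- The characters of the circle are the powers. -/
theorem exists_zpow_eq_circle_character (χ : PontryaginDual Circle) :
    ∃ m : ℤ, ∀ z, χ z = z ^ m := by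
  let ι : PontryaginDual Circle := ContinuousMonoidHom.id Circle
  -- The identity character alone separates points, so its powers exhaust the dual.
  have htop := subgroup_eq_top_of_separates circleHaar (Subgroup.zpowers ι)
    fun x y hxy => ⟨ι, Subgroup.mem_zpowers ι, hxy⟩
  obtain ⟨m, hm⟩ := Subgroup.mem_zpowers_iff.1 (htop ▸ Subgroup.mem_top χ)
  refine ⟨m, fun z => ?_⟩
  let ev : PontryaginDual Circle →* Circle :=
    { toFun := fun ψ => ψ z, map_one' := rfl, map_mul' := fun _ _ => rfl }
  have := map_zpow ev ι m
  rw [hm] at this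
  exact this

end CircleGroup

/-! ### Characters of the torus and lexicographic orders on its dual. -/

section Torus

variable {n : ℕ}

theorem exists_torus_degree (χ : PontryaginDual (Fin n → Circle)) (j : Fin n) :
    ∃ m : ℤ, ∀ z : Circle, χ (Pi.mulSingle j z) = z ^ m :=
  exists_zpow_eq_circle_character
    (ContinuousMonoidHom.comp (B := Fin n → Circle) χ
      ⟨MonoidHom.mulSingle (fun _ : Fin n => Circle) j,
        continuous_mulSingle (A := fun _ : Fin n => Circle) j⟩)

/-- The exponent of a character of the torus in the `j`-th coordinate. -/
noncomputable def torusDegree (χ : PontryaginDual (Fin n → Circle)) (j : Fin n) : ℤ :=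
  (exists_torus_degree χ j).choose

theorem torusDegree_spec (χ : PontryaginDual (Fin n → Circle)) (j : Fin n) (z : Circle) :
    χ (Pi.mulSingle j z) = z ^ torusDegree χ j :=
  (exists_torus_degree χ j).choose_spec z

theorem torusDegree_eq {χ : PontryaginDual (Fin n → Circle)} {j : Fin n} {m : ℤ}
    (h : ∀ z : Circle, χ (Pi.mulSingle j z) = z ^ m) : torusDegree χ j = m := by
  rw [← sub_eq_zero, ← Circle.zpow_eq_one_iff_forall]
  intro z
  rw [zpow_sub, ← torusDegree_spec, h, mul_inv_cancel]

theorem torusDegree_mul (χ ψ : PontryaginDual (Fin n → Circle)) (j : Fin n) :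
    torusDegree (χ * ψ) j = torusDegree χ j + torusDegree ψ j :=
  torusDegree_eq fun z => by
    rw [zpow_add, ← torusDegree_spec, ← torusDegree_spec]; rfl

theorem torusDegree_inv (χ : PontryaginDual (Fin n → Circle)) (j : Fin n) :
    torusDegree χ⁻¹ j = -torusDegree χ j :=
  torusDegree_eq fun z => by
    rw [zpow_neg, ← torusDegree_spec]; rfl

theorem torus_character_apply (χ : PontryaginDual (Fin n → Circle)) (θ : Fin n → Circle) :
    χ θ = ∏ j, θ j ^ torusDegree χ j := by
  conv_lhs => rw [← Finset.univ_prod_mulSingle θ]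
  rw [map_prod]
  exact Finset.prod_congr rfl fun j _ => torusDegree_spec χ j (θ j)

theorem torusDegree_eq_zero_iff {χ : PontryaginDual (Fin n → Circle)} :
    (∀ j, torusDegree χ j = 0) ↔ χ = 1 := by
  refine ⟨fun h => PontryaginDual.ext fun θ => ?_, ?_⟩
  · rw [torus_character_apply]
    simp [h]
  · rintro rfl j
    exact torusDegree_eq fun z => by simp

/-- A character of the torus depends nontrivially on the coordinate `k` and on no later one. -/
def IsLastCoord (χ : PontryaginDual (Fin n → Circle)) (k : Fin n) : Prop :=
  torusDegree χ k ≠ 0 ∧ ∀ j, k < j → torusDegree χ j = 0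

theorem exists_isLastCoord {χ : PontryaginDual (Fin n → Circle)} (h : χ ≠ 1) :
    ∃ k, IsLastCoord χ k := by
  classical
  rw [ne_eq, ← torusDegree_eq_zero_iff, not_forall] at h
  have hne : (Finset.univ.filter fun j => torusDegree χ j ≠ 0).Nonempty := by
    obtain ⟨j, hj⟩ := h
    exact ⟨j, by simpa using hj⟩
  refine ⟨_, (Finset.mem_filter.1 (Finset.max'_mem _ hne)).2, fun j hj => ?_⟩
  by_contra hj'
  exact absurd (Finset.le_max' _ j (by simpa using hj')) (not_le.2 hj)

theorem IsLastCoord.unique {χ : PontryaginDual (Fin n → Circle)} {k l : Fin n}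
    (hk : IsLastCoord χ k) (hl : IsLastCoord χ l) : k = l := by
  rcases lt_trichotomy k l with h | h | h
  · exact absurd (hk.2 l h) hl.1
  · exact h
  · exact absurd (hl.2 k h) hk.1

/-- The lexicographic order on the dual of the torus, read from the last coordinate, with
the sign of the `k`-th coordinate multiplied by `s k`. -/
def lexOrder (s : Fin n → ℤ) : Set (PontryaginDual (Fin n → Circle)) :=
  {χ | χ = 1 ∨ ∃ k, IsLastCoord χ k ∧ 0 < s k * torusDegree χ k}

theorem IsLastCoord.mem_lexOrder_iff {s : Fin n → ℤ} {χ : PontryaginDual (Fin n → Circle)}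
    {k : Fin n} (hk : IsLastCoord χ k) : χ ∈ lexOrder s ↔ 0 < s k * torusDegree χ k := by
  constructor
  · rintro (rfl | ⟨l, hl, h⟩)
    · exact absurd (torusDegree_eq_zero_iff.2 rfl k) hk.1
    · rwa [hk.unique hl]
  · exact fun h => Or.inr ⟨k, hk, h⟩

theorem IsLastCoord.inv {χ : PontryaginDual (Fin n → Circle)} {k : Fin n}
    (hk : IsLastCoord χ k) : IsLastCoord χ⁻¹ k :=
  ⟨by rw [torusDegree_inv]; exact neg_ne_zero.2 hk.1,
    fun j hj => by rw [torusDegree_inv, hk.2 j hj, neg_zero]⟩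

theorem IsLastCoord.ne_one {χ : PontryaginDual (Fin n → Circle)} {k : Fin n}
    (hk : IsLastCoord χ k) : χ ≠ 1 := by
  rintro rfl
  exact hk.1 (torusDegree_eq_zero_iff.2 rfl k)

/-- The last active coordinate of a product of two positive characters is the later of the two. In a
tie the signed exponents are both positive, so their sum cannot cancel. -/
theorem isGroupOrder_lexOrder {s : Fin n → ℤ} (hs : ∀ k, s k ≠ 0) :
    IsGroupOrder (lexOrder s) where
  mul_mem := by
    rintro a b (rfl | ⟨k, hk, hk'⟩) hb
    · rwa [one_mul]
    rcases hb with rfl | ⟨l, hl, hl'⟩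
    · rw [mul_one]
      exact Or.inr ⟨k, hk, hk'⟩
    right
    rcases lt_trichotomy k l with h | rfl | h
    · refine ⟨l, ⟨?_, fun j hj => ?_⟩, ?_⟩
      · rw [torusDegree_mul, hk.2 l h, zero_add]; exact hl.1
      · rw [torusDegree_mul, hk.2 j (h.trans hj), hl.2 j hj, zero_add]
      · rwa [torusDegree_mul, hk.2 l h, zero_add]
    · have hpos : 0 < s k * torusDegree (a * b) k := by
        rw [torusDegree_mul, mul_add]; exact add_pos hk' hl'
      refine ⟨k, ⟨fun h => ?_, fun j hj => ?_⟩, hpos⟩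
      · simp [h] at hpos
      · rw [torusDegree_mul, hk.2 j hj, hl.2 j hj, zero_add]
    · refine ⟨k, ⟨?_, fun j hj => ?_⟩, ?_⟩
      · rw [torusDegree_mul, hl.2 k h, add_zero]; exact hk.1
      · rw [torusDegree_mul, hk.2 j hj, hl.2 j (h.trans hj), zero_add]
      · rwa [torusDegree_mul, hl.2 k h, add_zero]
  mem_and_inv_mem_iff a := by
    refine ⟨fun h => ?_, ?_⟩
    · by_contra ha
      obtain ⟨k, hk⟩ := exists_isLastCoord ha
      rw [hk.mem_lexOrder_iff, hk.inv.mem_lexOrder_iff, torusDegree_inv] at h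
      linarith [h.1, h.2]
    · rintro rfl
      exact ⟨Or.inl rfl, Or.inl inv_one⟩
  mem_or_inv_mem a := by
    by_cases ha : a = 1
    · exact Or.inl (Or.inl ha)
    obtain ⟨k, hk⟩ := exists_isLastCoord ha
    rw [hk.mem_lexOrder_iff, hk.inv.mem_lexOrder_iff, torusDegree_inv, mul_neg, neg_pos]
    exact (lt_or_gt_of_ne (mul_ne_zero (hs k) hk.1)).symm

/-- Both signs are read off the same exponent `m`, and `sgn (s k * m) * sgn m = s k`. -/
theorem orderSgn_mul_orderSgn {s : Fin n → ℤ} {χ : PontryaginDual (Fin n → Circle)} {k : Fin n}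
    (hs : s k = 1 ∨ s k = -1) (hk : IsLastCoord χ k) :
    orderSgn (lexOrder s) χ * orderSgn (lexOrder 1) χ = s k := by
  simp only [orderSgn, if_neg hk.ne_one, hk.mem_lexOrder_iff, Pi.one_apply, one_mul]
  rcases hs with h | h <;> rcases lt_or_gt_of_ne hk.1 with h' | h' <;>
    simp [h, h', h'.not_gt]

theorem torus_characters_separate (x y : Fin n → Circle) (hxy : x ≠ y) :
    ∃ χ : PontryaginDual (Fin n → Circle), χ x ≠ χ y := by
  obtain ⟨j, hj⟩ := Function.ne_iff.1 hxy
  exact ⟨(⟨Pi.evalMonoidHom (fun _ : Fin n => Circle) j, continuous_apply j⟩ :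
    (Fin n → Circle) →ₜ* Circle), hj⟩

end Torus

/-! ### Martingale differences on the torus. -/

section TorusMartingale

variable {n : ℕ}

/-- Normalized Haar measure on the torus. -/
noncomputable abbrev torusHaar (n : ℕ) : Measure (Fin n → Circle) :=
  Measure.pi fun _ => circleHaar

/-- The point with the first `k` coordinates of `θ` and the other coordinates of `η`. -/
def torusMix (k : ℕ) (θ η : Fin n → Circle) : Fin n → Circle :=
  fun j => if (j : ℕ) < k then θ j else η j

theorem continuous_torusMix (k : ℕ) :
    Continuous fun q : (Fin n → Circle) × (Fin n → Circle) => torusMix k q.1 q.2 := by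
  refine continuous_pi fun j => ?_
  by_cases h : (j : ℕ) < k
  · simp only [torusMix, if_pos h]; fun_prop
  · simp only [torusMix, if_neg h]; fun_prop

/-- The preimage of a box is a product of two boxes, each factor constraining either `θ` or `η`.
This makes averaging over `η` the conditional expectation given the first `k` coordinates. -/
theorem measurePreserving_torusMix (k : ℕ) :
    MeasurePreserving (fun q : (Fin n → Circle) × (Fin n → Circle) => torusMix k q.1 q.2)
      ((torusHaar n).prod (torusHaar n)) (torusHaar n) := by
  refine ⟨(continuous_torusMix k).measurable, ?_⟩
  refine (Measure.pi_eq fun s hs => ?_).symm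
  rw [Measure.map_apply (continuous_torusMix k).measurable (MeasurableSet.univ_pi hs)]
  have : (fun q : (Fin n → Circle) × (Fin n → Circle) => torusMix k q.1 q.2) ⁻¹' Set.univ.pi s
      = (Set.univ.pi fun j : Fin n => if (j : ℕ) < k then s j else Set.univ) ×ˢ
        (Set.univ.pi fun j : Fin n => if (j : ℕ) < k then Set.univ else s j) := by
    ext q
    simp only [Set.mem_preimage, Set.mem_univ_pi, Set.mem_prod, torusMix, ← forall_and]
    refine forall_congr' fun j => ?_
    split_ifs <;> simp
  rw [this, Measure.prod_prod, Measure.pi_pi, Measure.pi_pi, ← Finset.prod_mul_distrib]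
  refine Finset.prod_congr rfl fun j _ => ?_
  split_ifs <;> simp

theorem torusMix_eq_mul (k : ℕ) (θ η : Fin n → Circle) :
    torusMix k θ η = torusMix k θ 1 * torusMix k 1 η := by
  ext j
  simp only [torusMix, Pi.mul_apply]
  split_ifs <;> simp

theorem charMap_torusMix (χ : PontryaginDual (Fin n → Circle)) (k : ℕ) (θ η : Fin n → Circle) :
    charMap χ (torusMix k θ η) = charMap χ (torusMix k θ 1) * charMap χ (torusMix k 1 η) := by
  rw [torusMix_eq_mul, charMap_apply_mul]

theorem charMap_torusMix_of_degree_eq_zero {χ : PontryaginDual (Fin n → Circle)} {k : ℕ}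
    (h : ∀ j : Fin n, k ≤ j → torusDegree χ j = 0) (θ η : Fin n → Circle) :
    charMap χ (torusMix k θ η) = charMap χ θ := by
  rw [charMap_apply, charMap_apply, torus_character_apply, torus_character_apply]
  congr 1
  refine Finset.prod_congr rfl fun j _ => ?_
  simp only [torusMix]
  split_ifs with hj
  · rfl
  · rw [h j (not_lt.1 hj), zpow_zero, zpow_zero]

theorem integral_charMap_torusMix {χ : PontryaginDual (Fin n → Circle)} {k : ℕ} {j : Fin n}
    (hkj : k ≤ j) (hj : torusDegree χ j ≠ 0) :
    ∫ η, charMap χ (torusMix k 1 η) ∂torusHaar n = 0 := by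
  -- Restricted to the coordinates from `k` on, `χ` is again a character, nontrivial because of
  -- coordinate `j`.
  let ψ : PontryaginDual (Fin n → Circle) :=
    { toFun := fun η => χ (torusMix k 1 η)
      map_one' := by
        rw [show torusMix k (1 : Fin n → Circle) 1 = 1 by ext; simp [torusMix], map_one]
      map_mul' := fun x y => by
        rw [← map_mul]
        congr 1
        ext i
        simp only [torusMix, Pi.mul_apply]
        split_ifs <;> simp
      continuous_toFun := (map_continuous χ).comp
        ((continuous_torusMix k).comp (Continuous.prodMk_right _)) }
  refine integral_charMap (torusHaar n) (χ := ψ) fun h => hj (torusDegree_eq fun z => ?_)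
  have h1 : ψ (Pi.mulSingle j z) = 1 := by rw [h]; rfl
  have h2 : torusMix k 1 (Pi.mulSingle j z) = Pi.mulSingle j z := by
    ext i
    simp only [torusMix]
    split_ifs with hi
    · rw [Pi.mulSingle_eq_of_ne (by rintro rfl; omega)]
      rfl
    · rfl
  rw [zpow_zero, ← h1]
  exact (congrArg χ h2).symm

variable {X : Type*} [NormedAddCommGroup X] [NormedSpace ℂ X] [CompleteSpace X]

theorem integral_torus_eq {F : (Fin n → Circle) → X} (hF : Integrable F (torusHaar n)) (k : ℕ) :
    ∫ θ, F θ ∂torusHaar n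
      = ∫ θ, ∫ η, F (torusMix k θ η) ∂torusHaar n ∂torusHaar n := by
  have hm := measurePreserving_torusMix (n := n) k
  rw [← hm.map_eq, integral_map hm.measurable.aemeasurable (by rw [hm.map_eq]; exact hF.1),
    hm.map_eq]
  exact integral_prod _ (hm.integrable_comp_of_integrable hF)

/-- A function of the first `k + 1` coordinates of mean zero in the last one has no Fourier
coefficients other than at characters with last coordinate `k`. -/
theorem integral_charMap_smul_torus_eq_zero {D : (Fin n → Circle) → X}
    (hD : Integrable D (torusHaar n)) {k : Fin n}
    (hdep : ∀ θ η, D (torusMix (k + 1) θ η) = D θ)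
    (hmean : ∀ᵐ θ ∂torusHaar n, ∫ η, D (torusMix k θ η) ∂torusHaar n = 0)
    {χ : PontryaginDual (Fin n → Circle)} (hχ : ¬ IsLastCoord χ k) :
    ∫ θ, charMap χ θ • D θ ∂torusHaar n = 0 := by
  have hint := integrable_continuousMap_smul (torusHaar n) hD (charMap χ)
  -- If `χ` is active beyond `k`, integrating out those coordinates kills it, since `D` is constant
  -- in them.
  by_cases h : ∃ j : Fin n, k < j ∧ torusDegree χ j ≠ 0
  · obtain ⟨j, hkj, hj⟩ := h
    rw [integral_torus_eq hint (k + 1)]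
    have e : ∀ θ η, charMap χ (torusMix (k + 1) θ η) • D (torusMix (k + 1) θ η)
        = (charMap χ (torusMix (k + 1) θ 1) * charMap χ (torusMix (k + 1) 1 η)) • D θ :=
      fun θ η => by rw [hdep, charMap_torusMix]
    simp only [e, integral_smul_const, integral_const_mul,
      integral_charMap_torusMix (k := k + 1) hkj hj, mul_zero, zero_smul, integral_zero]
  -- Otherwise `χ` is inactive from `k` on, so it factors out of the inner mean, which is zero.
  · push Not at h
    have hz : ∀ j : Fin n, (k : ℕ) ≤ j → torusDegree χ j = 0 := by
      intro j hj
      rcases (show k ≤ j from hj).lt_or_eq with h1 | rfl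
      · exact h j h1
      · by_contra h2
        exact hχ ⟨h2, h⟩
    rw [integral_torus_eq hint k]
    simp_rw [charMap_torusMix_of_degree_eq_zero hz, integral_smul]
    refine integral_eq_zero_of_ae ?_
    filter_upwards [hmean] with θ hθ
    rw [hθ, smul_zero, Pi.zero_apply]

/-- Sign changes of martingale differences on the torus. -/
theorem eLpNorm_sum_smul_torus_le {p : ℝ≥0∞} {A : ℝ≥0} (hA : ACFBound X p A) (hp1 : 1 ≤ p)
    (hp : p ≠ ∞) {D : Fin n → (Fin n → Circle) → X}
    (hD : ∀ k, MemLp (D k) p (torusHaar n))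
    (hdep : ∀ k θ η, D k (torusMix (k + 1) θ η) = D k θ)
    (hmean : ∀ k, ∀ᵐ θ ∂torusHaar n, ∫ η, D k (torusMix k θ η) ∂torusHaar n = 0)
    {ε : Fin n → ℝ} (hε : ∀ k, ε k = 1 ∨ ε k = -1) :
    eLpNorm (∑ k, ε k • D k) p (torusHaar n)
      ≤ (A ^ 2 : ℝ≥0) * eLpNorm (∑ k, D k) p (torusHaar n) := by
  obtain ⟨s, hs⟩ : ∃ s : Fin n → ℤ, ∀ k, (s k = 1 ∨ s k = -1) ∧ ε k = s k := by
    refine ⟨fun k => if ε k = 1 then 1 else -1, fun k => ?_⟩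
    rcases hε k with h | h <;> simp [h]
    norm_num
  have hs0 : ∀ k, s k ≠ 0 := fun k => by rcases (hs k).1 with h | h <;> simp [h]
  refine eLpNorm_le_of_acfBound (torusHaar n) hA hp1 hp torus_characters_separate
    (isGroupOrder_lexOrder hs0) (isGroupOrder_lexOrder (s := 1) fun k => one_ne_zero)
    (memLp_finsetSum' _ fun k _ => hD k)
    (memLp_finsetSum' _ fun k _ => (hD k).const_smul (ε k)) fun χ => ?_
  have hi : ∀ k, Integrable (fun θ => charMap χ⁻¹ θ • D k θ) (torusHaar n) := fun k =>
    integrable_continuousMap_smul _ ((hD k).integrable hp1) _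
  have e1 : ∀ θ, charMap χ⁻¹ θ • (∑ k, ε k • D k) θ
      = ∑ k, (s k : ℂ) • charMap χ⁻¹ θ • D k θ := fun θ => by
    simp only [Finset.sum_apply, Pi.smul_apply, Finset.smul_sum]
    refine Finset.sum_congr rfl fun k _ => ?_
    rw [(hs k).2, smul_comm (s k : ℂ), ← Complex.coe_smul, Complex.ofReal_intCast]
  have e2 : ∀ θ, charMap χ⁻¹ θ • (∑ k, D k) θ = ∑ k, charMap χ⁻¹ θ • D k θ := fun θ => by
    simp only [Finset.sum_apply, Finset.smul_sum]
  simp_rw [e1, e2]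
  rw [integral_finsetSum _ fun k _ => (hi k).fun_smul (s k : ℂ), integral_finsetSum _ fun k _ => hi k,
    Finset.smul_sum]
  refine Finset.sum_congr rfl fun k _ => ?_
  rw [integral_smul]
  by_cases hk : IsLastCoord χ k
  · rw [orderSgn_mul_orderSgn (hs k).1 hk]
  · rw [integral_charMap_smul_torus_eq_zero ((hD k).integrable hp1) (hdep k) (hmean k), smul_zero,
      smul_zero]
    intro h
    exact hk (by simpa using h.inv)

end TorusMartingale

/-! ### Realizing a finite sequence of random variables on the torus. -/

section Realization

/-- Noise outsourcing: a random variable `V` is, jointly with `U`, distributed as a function of `U`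
and an independent uniform variable on the circle. -/
theorem exists_circle_noise {Ω H Z : Type*} [MeasurableSpace Ω] [MeasurableSpace H]
    [MeasurableSpace Z] [StandardBorelSpace Z] [Nonempty Z] (μ : Measure Ω)
    [IsProbabilityMeasure μ] {U : Ω → H} {V : Ω → Z} (hV : Measurable V) :
    ∃ ρ : H → Circle → Z, Measurable (Function.uncurry ρ) ∧
      ((μ.map U).prod circleHaar).map (fun q => (q.1, ρ q.1 q.2)) = μ.map fun ω => (U ω, V ω) := by
  obtain ⟨v, hv⟩ := exists_measurePreserving_circle_unitInterval
  -- A kernel into a standard Borel space is a measurable family of images of the uniform measure on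
  -- `[0, 1]`; here it is the conditional law of `V` given `U`.
  obtain ⟨f, hf, hfκ⟩ := ProbabilityTheory.Kernel.exists_measurable_map_eq_unitInterval
    (ProbabilityTheory.condDistrib V U μ)
  have hρ : Measurable (Function.uncurry fun h z => f h (v z)) :=
    hf.comp (measurable_fst.prodMk (hv.measurable.comp measurable_snd))
  refine ⟨fun h z => f h (v z), hρ, ?_⟩
  have hm : Measurable fun q : H × Circle => (q.1, f q.1 (v q.2)) := measurable_fst.prodMk hρ
  rw [← ProbabilityTheory.compProd_map_condDistrib hV.aemeasurable]
  ext s hs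
  rw [Measure.map_apply hm hs, Measure.prod_apply (hm hs), Measure.compProd_apply hs]
  refine lintegral_congr fun h => ?_
  have hfh : Measurable (f h) := hf.of_uncurry_left
  rw [← hfκ h, ← hv.map_eq, Measure.map_map hfh hv.measurable,
    Measure.map_apply (hfh.comp hv.measurable) (measurable_prodMk_left hs)]
  rfl

variable {Z : Type*}

/-- The history obtained by applying the update rules `ρ` successively to the noise `θ`. -/
def noiseHistory (z₀ : Z) (ρ : ℕ → (ℕ → Z) → Circle → Z) (θ : ℕ → Circle) : ℕ → ℕ → Z
  | 0 => fun _ => z₀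
  | k + 1 => Function.update (noiseHistory z₀ ρ θ k) k (ρ k (noiseHistory z₀ ρ θ k) (θ k))

theorem noiseHistory_congr (z₀ : Z) (ρ : ℕ → (ℕ → Z) → Circle → Z) {θ η : ℕ → Circle} {k : ℕ}
    (h : ∀ j < k, θ j = η j) : noiseHistory z₀ ρ θ k = noiseHistory z₀ ρ η k := by
  induction k with
  | zero => rfl
  | succ k ih =>
    simp only [noiseHistory]
    rw [ih fun j hj => h j (hj.trans k.lt_succ_self), h k k.lt_succ_self]

theorem noiseHistory_apply (z₀ : Z) (ρ : ℕ → (ℕ → Z) → Circle → Z) (θ : ℕ → Circle) {j k : ℕ}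
    (h : j < k) : noiseHistory z₀ ρ θ k j = ρ j (noiseHistory z₀ ρ θ j) (θ j) := by
  induction k with
  | zero => omega
  | succ k ih =>
    rcases Nat.lt_succ_iff_lt_or_eq.1 h with h | rfl
    · simp only [noiseHistory]
      rw [Function.update_of_ne h.ne, ih h]
    · simp [noiseHistory]

/-- Extension of a point of the torus by `1`. -/
noncomputable def torusExtend {n : ℕ} (θ : Fin n → Circle) (j : ℕ) : Circle :=
  if h : j < n then θ ⟨j, h⟩ else 1

theorem measurable_torusExtend {n : ℕ} : Measurable (torusExtend : (Fin n → Circle) → _) := by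
  refine measurable_pi_lambda _ fun j => ?_
  by_cases h : j < n
  · simp only [torusExtend, dif_pos h]
    exact measurable_pi_apply _
  · simp only [torusExtend, dif_neg h]
    exact measurable_const

theorem torusExtend_coe {n : ℕ} (θ : Fin n → Circle) (j : Fin n) : torusExtend θ j = θ j := by
  simp [torusExtend]

theorem torusExtend_torusMix {n k j : ℕ} (h : j < k) (θ η : Fin n → Circle) :
    torusExtend (torusMix k θ η) j = torusExtend θ j := by
  simp only [torusExtend, torusMix, h, if_true]

variable [MeasurableSpace Z]

theorem measurable_noiseHistory (z₀ : Z) {ρ : ℕ → (ℕ → Z) → Circle → Z}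
    (hρ : ∀ k, Measurable (Function.uncurry (ρ k))) (k : ℕ) :
    Measurable fun θ => noiseHistory z₀ ρ θ k := by
  induction k with
  | zero => exact measurable_const
  | succ k ih =>
    refine measurable_pi_lambda _ fun j => ?_
    by_cases hj : j = k
    · subst hj
      simp only [noiseHistory, Function.update_self]
      exact (hρ j).comp (ih.prodMk (measurable_pi_apply j))
    · simp only [noiseHistory, Function.update_of_ne hj]
      exact (measurable_pi_apply j).comp ih

/-- The first `k` values of a sequence, extended by `z₀`. -/
def truncatedHistory {Ω : Type*} (z₀ : Z) (Y : ℕ → Ω → Z) (k : ℕ) (ω : Ω) (j : ℕ) : Z :=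
  if j < k then Y j ω else z₀

theorem measurable_truncatedHistory {Ω : Type*} {m : MeasurableSpace Ω} (z₀ : Z) {Y : ℕ → Ω → Z}
    {k : ℕ} (hY : ∀ j < k, Measurable (Y j)) : Measurable (truncatedHistory z₀ Y k) := by
  refine measurable_pi_lambda _ fun j => ?_
  by_cases h : j < k
  · simpa only [truncatedHistory, if_pos h] using hY j h
  · simp only [truncatedHistory, if_neg h]
    exact measurable_const

variable [StandardBorelSpace Z] {X : Type*} [NormedAddCommGroup X] [NormedSpace ℂ X] [CompleteSpace X]

/-- Every finite sequence of random variables has the same distribution as a sequence on the torus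
whose `k`-th term is a function of the first `k + 1` coordinates. A martingale difference property
is preserved. -/
theorem exists_torus_realization {Ω : Type*} [MeasurableSpace Ω] (μ : Measure Ω)
    [IsProbabilityMeasure μ] (z₀ : Z) {c : Z → X} (hc : StronglyMeasurable c) {Y : ℕ → Ω → Z}
    (hY : ∀ k, Measurable (Y k)) (hint : ∀ k, Integrable (fun ω => c (Y k ω)) μ)
    (hzero : ∀ k (B : Set (ℕ → Z)), MeasurableSet B →
      ∫ ω in truncatedHistory z₀ Y k ⁻¹' B, c (Y k ω) ∂μ = 0) (n : ℕ) :
    ∃ R : (Fin n → Circle) → ℕ → Z, Measurable R ∧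
      (torusHaar n).map R = μ.map (truncatedHistory z₀ Y n) ∧
      (∀ (k : Fin n) θ η, R (torusMix (k + 1) θ η) k = R θ k) ∧
      ∀ k : Fin n, ∀ᵐ θ ∂torusHaar n, ∫ η, c (R (torusMix k θ η) k) ∂torusHaar n = 0 := by
  have : Nonempty Z := ⟨z₀⟩
  have hW : ∀ k, Measurable (truncatedHistory z₀ Y k) := fun k =>
    measurable_truncatedHistory z₀ fun j _ => hY j
  choose ρ hρ hlaw using fun k => exists_circle_noise μ (U := truncatedHistory z₀ Y k) (hY k)
  let S : ℕ → (Fin n → Circle) → ℕ → Z := fun k θ => noiseHistory z₀ ρ (torusExtend θ) k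
  have hS : ∀ k, Measurable (S k) := fun k =>
    (measurable_noiseHistory z₀ hρ k).comp measurable_torusExtend
  have hSmix : ∀ {k l : ℕ}, k ≤ l → ∀ θ η, S k (torusMix l θ η) = S k θ := fun hkl θ η =>
    noiseHistory_congr z₀ ρ fun j hj => torusExtend_torusMix (hj.trans_le hkl) θ η
  have hSn : ∀ (k : Fin n) θ, S n θ k = ρ k (S k θ) (θ k) := fun k θ => by
    rw [← torusExtend_coe θ k]
    exact noiseHistory_apply z₀ ρ _ k.2
  -- `S k` reads only the coordinates below `k`, hence is independent of coordinate `k`.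
  have hindep : ∀ k : Fin n, (torusHaar n).map (fun θ => (S k θ, θ k))
      = ((torusHaar n).map (S k)).prod circleHaar := by
    intro k
    have hm := measurePreserving_torusMix (n := n) k
    have h1 : (fun θ => (S k θ, θ k)) ∘
          (fun q : (Fin n → Circle) × (Fin n → Circle) => torusMix k q.1 q.2)
        = Prod.map (S k) (fun η => η k) := by
      ext1 q
      simp only [Function.comp, Prod.map, hSmix le_rfl]
      simp [torusMix]
    rw [← hm.map_eq, Measure.map_map ((hS k).prodMk (measurable_pi_apply k)) hm.measurable, h1,
      ← Measure.map_prod_map _ _ (hS k) (measurable_pi_apply k), hm.map_eq,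
      (measurePreserving_eval (fun _ : Fin n => circleHaar) k).map_eq]
  have hSlaw : ∀ k ≤ n, (torusHaar n).map (S k) = μ.map (truncatedHistory z₀ Y k) := by
    intro k hk
    induction k with
    | zero =>
      have h1 : S 0 = fun _ _ => z₀ := rfl
      have h2 : truncatedHistory z₀ Y 0 = fun _ _ => z₀ := by
        ext; simp [truncatedHistory]
      rw [h1, h2, Measure.map_const, Measure.map_const]
      simp
    | succ k ih =>
      have ih := ih (Nat.le_of_succ_le hk)
      let upd : (ℕ → Z) × Z → ℕ → Z := fun q => Function.update q.1 k q.2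
      have hupd : Measurable upd := by
        refine measurable_pi_lambda _ fun j => ?_
        by_cases hj : j = k
        · subst hj
          simpa only [upd, Function.update_self] using measurable_snd
        · simp only [upd, Function.update_of_ne hj]
          exact (measurable_pi_apply j).comp measurable_fst
      have h1 : S (k + 1) = upd ∘ (fun q => (q.1, ρ k q.1 q.2)) ∘
          fun θ : Fin n → Circle => (S k θ, θ ⟨k, hk⟩) := by
        ext1 θ
        simp only [S, noiseHistory, upd, Function.comp]
        rw [← torusExtend_coe θ ⟨k, hk⟩]
      have h2 : truncatedHistory z₀ Y (k + 1)
          = upd ∘ fun ω => (truncatedHistory z₀ Y k ω, Y k ω) := by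
        ext ω j
        simp only [truncatedHistory, upd, Function.comp, Function.update_apply]
        split_ifs <;> first | rfl | (subst_vars; rfl) | omega
      have hg : Measurable fun q : (ℕ → Z) × Circle => (q.1, ρ k q.1 q.2) :=
        measurable_fst.prodMk (hρ k)
      have hp : Measurable fun θ : Fin n → Circle => (S k θ, θ ⟨k, hk⟩) :=
        (hS k).prodMk (measurable_pi_apply _)
      rw [h1, h2, ← Measure.map_map hupd ((hW k).prodMk (hY k)), ← hlaw k,
        ← Measure.map_map hupd (hg.comp hp), ← Measure.map_map hg hp, hindep ⟨k, hk⟩, ih]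
  refine ⟨S n, hS n, hSlaw n le_rfl, fun k θ η => ?_, fun k => ?_⟩
  · rw [hSn, hSn, hSmix k.1.le_succ]
    simp [torusMix]
  · have hg : Measurable fun q : (ℕ → Z) × Circle => (q.1, ρ k q.1 q.2) :=
      measurable_fst.prodMk (hρ k)
    have hWY : Measurable fun ω => (truncatedHistory z₀ Y k ω, Y k ω) := (hW k).prodMk (hY k)
    have hcs : StronglyMeasurable fun q : (ℕ → Z) × Z => c q.2 := hc.comp_measurable measurable_snd
    have hi : Integrable (fun q : (ℕ → Z) × Circle => c (ρ k q.1 q.2))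
        ((μ.map (truncatedHistory z₀ Y k)).prod circleHaar) := by
      have h1 : Integrable (fun q : (ℕ → Z) × Z => c q.2)
          (μ.map fun ω => (truncatedHistory z₀ Y k ω, Y k ω)) :=
        (integrable_map_measure hcs.aestronglyMeasurable hWY.aemeasurable).2 (hint k)
      rw [← hlaw k] at h1
      exact (integrable_map_measure hcs.aestronglyMeasurable hg.aemeasurable).1 h1
    -- Over a set `B` of histories, the inner mean integrates to the integral of `c (Y k)` over the
    -- event that the history lies in `B`, which `hzero` makes zero.
    have hmean : ∀ᵐ s ∂μ.map (truncatedHistory z₀ Y k), ∫ z, c (ρ k s z) ∂circleHaar = 0 := by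
      refine hi.integral_prod_left.ae_eq_zero_of_forall_setIntegral_eq_zero fun B hB _ => ?_
      have hi' := hi.integrableOn (s := B ×ˢ Set.univ)
      rw [← hzero k B hB]
      have h1 := setIntegral_prod _ hi'
      rw [Measure.restrict_univ] at h1
      rw [← h1]
      have hBm : MeasurableSet ((Prod.fst : (ℕ → Z) × Z → ℕ → Z) ⁻¹' B) := measurable_fst hB
      have h2 := setIntegral_map hBm hcs.aestronglyMeasurable hg.aemeasurable
        (μ := (μ.map (truncatedHistory z₀ Y k)).prod circleHaar)
      have h3 := setIntegral_map hBm hcs.aestronglyMeasurable hWY.aemeasurable (μ := μ)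
      rw [← hlaw k, h2] at h3
      rw [Set.prod_univ]
      exact h3
    rw [← hSlaw k k.2.le] at hmean
    filter_upwards [ae_of_ae_map (hS k).aemeasurable hmean] with θ hθ
    simp only [hSn, hSmix le_rfl]
    have hcθ : StronglyMeasurable fun z => c (ρ k (S k θ) z) :=
      hc.comp_measurable ((hρ k).of_uncurry_left)
    have hev := measurePreserving_eval (fun _ : Fin n => circleHaar) k
    rw [← hθ]
    rw [← hev.map_eq, integral_map hev.measurable.aemeasurable hcθ.aestronglyMeasurable]
    simp [torusMix]

end Realization

/-! ### Transfer to arbitrary martingales. -/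

section Transference

variable {X : Type*} [NormedAddCommGroup X] [NormedSpace ℂ X] [CompleteSpace X]

/-- Sign changes of sequences that are conditionally centred, including the first term. -/
theorem eLpNorm_sum_smul_le_of_setIntegral_eq_zero {Ω : Type*} {m₀ : MeasurableSpace Ω}
    (μ : Measure Ω) [IsProbabilityMeasure μ] {p : ℝ≥0∞} {A : ℝ≥0} (hA : ACFBound X p A)
    (hp1 : 1 ≤ p) (hp : p ≠ ∞) {d : ℕ → Ω → X} (m : ℕ → MeasurableSpace Ω)
    (hdm : ∀ k, StronglyMeasurable (d k)) (hd : ∀ k, MemLp (d k) p μ)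
    (hadapt : ∀ k, ∀ j < k, StronglyMeasurable[m k] (d j))
    (hzero : ∀ k s, MeasurableSet[m k] s → ∫ ω in s, d k ω ∂μ = 0)
    {ε : ℕ → ℝ} (hε : ∀ k, ε k = 1 ∨ ε k = -1) (n : ℕ) :
    eLpNorm (∑ k ∈ Finset.range n, ε k • d k) p μ
      ≤ (A ^ 2 : ℝ≥0) * eLpNorm (∑ k ∈ Finset.range n, d k) p μ := by
  borelize X
  -- `X` may be nonseparable; all values lie in this closed separable set, a Polish space, as noise
  -- outsourcing requires.
  let K : Set X := closure (⋃ k, Set.range (d k))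
  have hKsep : TopologicalSpace.IsSeparable K :=
    (TopologicalSpace.IsSeparable.iUnion fun k => (hdm k).isSeparable_range).closure
  have hKmem : ∀ k ω, d k ω ∈ K := fun k ω =>
    subset_closure (Set.mem_iUnion.2 ⟨k, Set.mem_range_self ω⟩)
  have : TopologicalSpace.SeparableSpace K := hKsep.separableSpace
  have : SecondCountableTopology K := UniformSpace.secondCountable_of_separable K
  have : CompleteSpace K := isClosed_closure.completeSpace_coe
  have : PolishSpace K := inferInstance
  obtain ⟨ω₀⟩ : Nonempty Ω := μ.nonempty_of_neZero
  let z₀ : K := ⟨d 0 ω₀, hKmem 0 ω₀⟩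
  let Y : ℕ → Ω → K := fun k ω => ⟨d k ω, hKmem k ω⟩
  have hY : ∀ k, Measurable (Y k) := fun k => (hdm k).measurable.subtype_mk
  have hc : StronglyMeasurable (Subtype.val : K → X) := continuous_subtype_val.stronglyMeasurable
  obtain ⟨R, hR, hRlaw, hRdep, hRmean⟩ := exists_torus_realization μ z₀ hc hY
    (fun k => (hd k).integrable hp1) (fun k B hB => by
      refine hzero k _ ?_
      exact measurable_truncatedHistory (m := m k) z₀
        (fun j hj => (hadapt k j hj).measurable.subtype_mk) hB) n
  have hW : Measurable (truncatedHistory z₀ Y n) :=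
    measurable_truncatedHistory z₀ fun j _ => hY j
  let F : (Fin n → ℝ) → (ℕ → K) → X := fun a y => ∑ k, a k • (y k : X)
  have hF : ∀ a, StronglyMeasurable (F a) := fun a =>
    Finset.stronglyMeasurable_fun_sum _ fun k _ =>
      (hc.comp_measurable (measurable_pi_apply (k : ℕ))).const_smul (a k)
  -- Each norm is a functional of the law of the history, which `R` reproduces.
  have htrans : ∀ a : ℕ → ℝ, eLpNorm (∑ k ∈ Finset.range n, a k • d k) p μ
      = eLpNorm (∑ k : Fin n, a k • fun θ => (R θ k : X)) p (torusHaar n) := by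
    intro a
    have h1 : (∑ k ∈ Finset.range n, a k • d k)
        = F (fun k => a k) ∘ truncatedHistory z₀ Y n := by
      ext ω
      rw [Finset.sum_range]
      simp [F, truncatedHistory, Y]
    have h2 : (∑ k : Fin n, a k • fun θ => (R θ k : X)) = F (fun k => a k) ∘ R := by
      ext θ
      simp [F]
    rw [h1, h2, ← eLpNorm_map_measure (hF _).aestronglyMeasurable hW.aemeasurable,
      ← eLpNorm_map_measure (hF _).aestronglyMeasurable hR.aemeasurable, hRlaw]
  have hmem : ∀ k : Fin n, MemLp (fun θ => (R θ k : X)) p (torusHaar n) := by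
    intro k
    have hck : StronglyMeasurable fun y : ℕ → K => (y k : X) :=
      hc.comp_measurable (measurable_pi_apply (k : ℕ))
    refine (memLp_map_measure_iff hck.aestronglyMeasurable hR.aemeasurable).1 ?_
    rw [hRlaw, memLp_map_measure_iff hck.aestronglyMeasurable hW.aemeasurable]
    convert hd k using 1
    ext ω
    simp [truncatedHistory, Y]
  have key := eLpNorm_sum_smul_torus_le hA hp1 hp hmem
    (fun k θ η => congrArg Subtype.val (hRdep k θ η)) hRmean (ε := fun k => ε k) fun k => hε k
  have h1 := htrans fun _ => 1
  simp only [one_smul] at h1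
  rw [htrans ε, h1]
  exact key

/-- The differences are replaced by `z • d k` on `Circle × Ω`, with `z` uniform on the circle, so
that the term of index 0 is centred too. -/
theorem umdBound_of_acfBound {X : Type u} [NormedAddCommGroup X] [NormedSpace ℂ X]
    [CompleteSpace X] {p : ℝ≥0∞} (hp1 : 1 ≤ p) (hp : p ≠ ∞) {A : ℝ≥0} (hA : ACFBound X p A) :
    UMDBound.{u, w} X p (A ^ 2) := by
  intro Ω m₀ μ _ ℱ d hmart hd ε hε n
  have hsum : ∀ k, StronglyMeasurable[ℱ k] (∑ j ∈ Finset.range (k + 1), d j) :=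
    fun k => hmart.1 k
  have hsub : ∀ k, d (k + 1) = (∑ j ∈ Finset.range (k + 1 + 1), d j)
      - ∑ j ∈ Finset.range (k + 1), d j := fun k => by
    rw [Finset.sum_range_succ _ (k + 1), add_sub_cancel_left]
  have hadapt : ∀ k, StronglyMeasurable[ℱ k] (d k) := by
    rintro (_ | k)
    · simpa using hsum 0
    · rw [hsub]
      exact (hsum (k + 1)).sub ((hsum k).mono (ℱ.mono k.le_succ))
  have hdiff : ∀ k s, MeasurableSet[ℱ k] s → ∫ ω in s, d (k + 1) ω ∂μ = 0 := by
    intro k s hs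
    rw [hsub]
    simp only [Pi.sub_apply]
    rw [integral_sub (hmart.integrable (k + 1)).integrableOn (hmart.integrable k).integrableOn,
      hmart.setIntegral_eq k.le_succ hs, sub_self]
  have hdm : ∀ k, StronglyMeasurable (d k) := fun k => (hadapt k).mono (ℱ.le k)
  let ν : Measure (Circle × Ω) := circleHaar.prod μ
  have hcoe : StronglyMeasurable fun z : Circle => (z : ℂ) :=
    (show Continuous fun z : Circle => (z : ℂ) from continuous_subtype_val).stronglyMeasurable
  have hsm : ∀ (m : MeasurableSpace Ω) {f : Ω → X}, StronglyMeasurable[m] f →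
      StronglyMeasurable fun q : Circle × Ω => (q.1 : ℂ) • f q.2 := fun m f hf =>
    (hcoe.comp_measurable measurable_fst).smul
      (hf.comp_measurable measurable_snd)
  have hnorm : ∀ (f : Ω → X), StronglyMeasurable f →
      eLpNorm (fun q : Circle × Ω => (q.1 : ℂ) • f q.2) p ν = eLpNorm f p μ := by
    intro f hf
    have hsnd : MeasurePreserving (Prod.snd : Circle × Ω → Ω) ν μ := measurePreserving_snd
    rw [← eLpNorm_comp_measurePreserving hf.aestronglyMeasurable hsnd]
    refine eLpNorm_congr_norm_ae (Filter.Eventually.of_forall fun q => ?_)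
    rw [norm_smul, Circle.norm_coe, one_mul, Function.comp]
  have hdν : ∀ k, MemLp (fun q : Circle × Ω => (q.1 : ℂ) • d k q.2) p ν := fun k =>
    ⟨(hsm m₀ (hdm k)).aestronglyMeasurable, by rw [hnorm _ (hdm k)]; exact (hd k).2⟩
  have hcirc : ∫ z : Circle, (z : ℂ) ∂circleHaar = 0 := by
    refine integral_charMap circleHaar (χ := (ContinuousMonoidHom.id Circle : Circle →ₜ* Circle))
      fun h => ?_
    have := DFunLike.congr_fun h (Circle.exp Real.pi)
    exact Circle.exp_pi_ne_one this
  -- `m k` is the information available before step `k`: trivial at 0, then `z` together with `ℱ (k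
  -- - 1)`.
  let m : ℕ → MeasurableSpace (Circle × Ω) := fun k =>
    Nat.casesOn k ⊥ fun k => @Prod.instMeasurableSpace _ _ _ (ℱ k)
  have key := eLpNorm_sum_smul_le_of_setIntegral_eq_zero ν hA hp1 hp m
    (fun k => hsm m₀ (hdm k)) hdν ?_ ?_ hε n
  · have h1 : ∀ a : ℕ → ℝ, eLpNorm (∑ k ∈ Finset.range n,
        a k • fun q : Circle × Ω => (q.1 : ℂ) • d k q.2) p ν
        = eLpNorm (∑ k ∈ Finset.range n, a k • d k) p μ := by
      intro a
      rw [← hnorm _ (Finset.stronglyMeasurable_sum _ fun k _ => (hdm k).const_smul (a k))]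
      congr 1
      ext q
      simp only [Finset.sum_apply, Pi.smul_apply, Finset.smul_sum]
      exact Finset.sum_congr rfl fun k _ => smul_comm _ _ _
    have h2 := h1 fun _ => 1
    simp only [one_smul] at h2
    rwa [h1, h2] at key
  · rintro (_ | k) j hj
    · omega
    · exact @hsm (ℱ k) _ ((hadapt j).mono (ℱ.mono (Nat.lt_succ_iff.1 hj)))
  · rintro (_ | k) s hs
    · have hfull : ∫ q, (q.1 : ℂ) • d 0 q.2 ∂ν = 0 := by
        rw [integral_prod_smul (fun z : Circle => (z : ℂ)) (d 0), hcirc, zero_smul]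
      rcases MeasurableSpace.measurableSet_bot_iff.1 hs with rfl | rfl
      · simp
      · rw [setIntegral_univ, hfull]
    · have hle : @Prod.instMeasurableSpace Circle Ω _ (ℱ k) ≤ Prod.instMeasurableSpace :=
        sup_le_sup le_rfl (MeasurableSpace.comap_mono (ℱ.le k))
      have hs₀ : MeasurableSet s := hle s hs
      rw [← integral_indicator hs₀, integral_prod _
        (((hdν (k + 1)).integrable hp1).indicator hs₀)]
      -- For fixed `z` the slice of `s` lies in `ℱ k`, over which `d (k + 1)` integrates to zero.
      refine integral_eq_zero_of_ae (Filter.Eventually.of_forall fun z => ?_)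
      have hz : MeasurableSet[ℱ k] (Prod.mk z ⁻¹' s) :=
        @measurable_prodMk_left Circle Ω _ (ℱ k) z s hs
      have e : ∀ ω, s.indicator (fun q : Circle × Ω => (q.1 : ℂ) • d (k + 1) q.2) (z, ω)
          = (z : ℂ) • (Prod.mk z ⁻¹' s).indicator (d (k + 1)) ω := fun ω => by
        by_cases h : (z, ω) ∈ s <;> simp [Set.indicator, h]
      simp only [e, integral_smul, Pi.zero_apply]
      rw [integral_indicator (ℱ.le k _ hz), hdiff k _ hz, smul_zero]

end Transference

theorem theorem3p1 (X : Type u) [NormedAddCommGroup X] [NormedSpace ℂ X] [CompleteSpace X]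
    (p : ℝ≥0∞) (hp : 1 < p) (hp' : p < ∞) (hX : HasACF X) :
    HasUMD.{u, w} X ∧
      ∀ A : ℝ≥0, ACFBound X p A → UMDBound.{u, w} X p (A ^ 2) := by
  refine ⟨?_, fun A hA => umdBound_of_acfBound hp.le hp'.ne hA⟩
  -- The exponent `q` of the ACF property may differ from `p`; the UMD property is obtained at `q`.
  obtain ⟨q, hq, hq', A, hA⟩ := hX
  exact ⟨q, hq, hq', A ^ 2, umdBound_of_acfBound hq.le hq'.ne hA⟩
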